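/- Let $\Gamma\subset\mathbb C$ be a lattice (a discrete additive subgroup of rank $2$), let $\wp(z;\Gamma)=\frac1{z^2}+\sum_{u\in\Gamma\setminus\{0\}}\left(\frac1{(z-u)^2}-\frac1{u^2}\right)$ be its Weierstrass function, and let $g_2(\Gamma)=60\sum_{u\in\Gamma\setminus\{0\}}u^{-4}$, $g_3(\Gamma)=140\sum_{u\in\Gamma\setminus\{0\}}u^{-6}$. Call a triple $(e_1,e_2,e_3)$ of complex numbers properly ordered if $|e_2-e_3|\le|e_1-e_3|\le|e_1-e_2|$. Call $\omega_1,\omega_2$ a reduced basis of $\Gamma$ if $\omega_1\in\Gamma\setminus\{0\}$ and $|\omega_1|=\inf\{|w|:w\in\Gamma\setminus\{0\}\}$, and $\omega_2\in\Gamma\setminus\omega_1\mathbb Z$ and $|\omega_2|=\inf\{|w|:w\in\Gamma\setminus\omega_1\mathbb Z\}$. Let $(e_1,e_2,e_3)$ be a properly ordered triple of (pairwise) distinct roots of the polynomial $4x^3-g_2(\Gamma)x-g_3(\Gamma)$. Then there exists a reduced basis $\omega_1,\omega_2$ of $\Gamma$ such that $$e_1=\wp\left(\frac{\omega_1}2;\Gamma\right),\quad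 e_2=\wp\left(\frac{\omega_2}2;\Gamma\right),\quad e_3=\wp\left(\frac{\omega_1+\omega_2}2;\Gamma\right).$$ -/

import Mathlib

/-- The polynomial `4x³ - g₂(Γ)x - g₃(Γ)` attached to the lattice `Γ = L.lattice`. -/
noncomputable def weierstrassCubic (L : PeriodPair) : Polynomial ℂ :=
  Polynomial.C 4 * Polynomial.X ^ 3 - Polynomial.C L.g₂ * Polynomial.X - Polynomial.C L.g₃

/-- A triple `(e₁, e₂, e₃)` of complex numbers is properly ordered if
`|e₂ - e₃| ≤ |e₁ - e₃| ≤ |e₁ - e₂|`. -/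
def ProperlyOrdered (e₁ e₂ e₃ : ℂ) : Prop :=
  ‖e₂ - e₃‖ ≤ ‖e₁ - e₃‖ ∧ ‖e₁ - e₃‖ ≤ ‖e₁ - e₂‖

/-- `ω₁, ω₂` is a reduced basis of `Γ`: `ω₁` attains the infimum of `|w|` over `w ∈ Γ \ {0}` and
`ω₂` attains the infimum of `|w|` over `w ∈ Γ \ ω₁ℤ`. -/
def IsReducedBasis (Γ : Submodule ℤ ℂ) (ω₁ ω₂ : ℂ) : Prop :=
  (ω₁ ∈ (Γ : Set ℂ) \ {0} ∧
    ‖ω₁‖ = sInf ((fun w : ℂ => ‖w‖) '' ((Γ : Set ℂ) \ {0}))) ∧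
  (ω₂ ∈ (Γ : Set ℂ) \ Set.range (fun n : ℤ => (n : ℂ) * ω₁) ∧
    ‖ω₂‖ = sInf ((fun w : ℂ => ‖w‖) '' ((Γ : Set ℂ) \ Set.range (fun n : ℤ => (n : ℂ) * ω₁))))

open Filter Topology ComplexConjugate

/-! Reduction theory gives periods a, b, c with sum zero, two of which span the lattice, forming a
triangle with no obtuse angle. Their half period values are the three roots of the cubic. The key
comparison is `norm_sub_lt`: a shorter period a than b forces ℘(a/2) to lie farther than ℘(b/2) from
℘(c/2). Hence a properly ordered labelling satisfies |a| ≤ |b| ≤ |c|, and Selling's formula makes a,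
b a reduced basis.

For the comparison, normalise c = 1, a = τ, b = -(τ + 1), and follow the difference of the two
distances (`halfPeriodDefect`) as τ varies. It is continuous, positive at τ = i, and the relevant
region can be reached from i by a vertical and a horizontal segment, so it suffices that it never
vanishes there. If two distances agree, some map z ↦ v * conj z with |v| = 1 permutes the three
roots. The corresponding reflected lattice has the same g₂ and g₃, hence is the same lattice
(`mem_lattice_iff_of_invariants_eq`), and the reflection carries a to a period of length |a| in the
class of b modulo 2Γ. In the region every such period is longer than a. -/

namespace PeriodPair

/-! ### Poles, differential equations and half period values of ℘ -/

/-- Two functions meromorphic on `ℂ` that agree near one point agree near every point. -/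
lemma meromorphic_eventuallyEq {f g : ℂ → ℂ} (hf : Meromorphic f) (hg : Meromorphic g) {x : ℂ}
    (h : f =ᶠ[𝓝[≠] x] g) (y : ℂ) : f =ᶠ[𝓝[≠] y] g := by
  have hm : MeromorphicOn (fun z => f z - g z) Set.univ := fun z _ => (hf z).fun_sub (hg z)
  have hx : meromorphicOrderAt (fun z => f z - g z) x = ⊤ := by
    rw [meromorphicOrderAt_eq_top_iff]
    filter_upwards [h] with z hz
    rw [hz, sub_self]
  have hy : meromorphicOrderAt (fun z => f z - g z) y = ⊤ := by
    by_contra hne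
    exact hm.meromorphicOrderAt_ne_top_of_isPreconnected isPreconnected_univ
      (Set.mem_univ y) (Set.mem_univ x) hne hx
  rw [meromorphicOrderAt_eq_top_iff] at hy
  filter_upwards [hy] with z hz
  exact sub_eq_zero.mp hz

variable (L : PeriodPair)

lemma weierstrassP_order_nonneg {z : ℂ} (hz : z ∉ L.lattice) :
    0 ≤ meromorphicOrderAt L.weierstrassP z :=
  (L.analyticOnNhd_weierstrassP z hz).meromorphicOrderAt_nonneg

lemma mem_lattice_iff_order (z : ℂ) :
    z ∈ L.lattice ↔ meromorphicOrderAt L.weierstrassP z < 0 := by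
  refine ⟨fun h => ?_, fun h => ?_⟩
  · rw [L.order_weierstrassP z h]; decide
  · by_contra hz
    exact absurd h (L.weierstrassP_order_nonneg hz).not_gt

/-- If two translates of Weierstrass functions agree near a point, their poles agree. -/
lemma mem_lattice_iff_of_eventuallyEq (L' : PeriodPair) {a b x : ℂ}
    (h : (fun z => L.weierstrassP (z + a)) =ᶠ[𝓝[≠] x] fun z => L'.weierstrassP (z + b)) (y : ℂ) :
    y + a ∈ L.lattice ↔ y + b ∈ L'.lattice := by
  have hf : Meromorphic fun z => L.weierstrassP (z + a) := fun z =>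
    (L.meromorphic_weierstrassP (z + a)).comp_analyticAt (g := fun w => w + a) (by fun_prop)
  have hg : Meromorphic fun z => L'.weierstrassP (z + b) := fun z =>
    (L'.meromorphic_weierstrassP (z + b)).comp_analyticAt (g := fun w => w + b) (by fun_prop)
  have hy := meromorphicOrderAt_congr (meromorphic_eventuallyEq hf hg h y)
  rw [L.mem_lattice_iff_order, L'.mem_lattice_iff_order,
    ← meromorphicOrderAt_comp_add_const_eq_meromorphicOrderAt,
    ← meromorphicOrderAt_comp_add_const_eq_meromorphicOrderAt]
  exact iff_of_eq (congrArg (· < 0) hy)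

/-- The triple pole at 0 prevents ℘' from vanishing identically near any point, so ℘' can be
cancelled from identities. -/
lemma order_derivWeierstrassP_ne_top (z : ℂ) :
    meromorphicOrderAt L.derivWeierstrassP z ≠ ⊤ := by
  have h0 : meromorphicOrderAt L.derivWeierstrassP 0 = ((-3 : ℤ) : WithTop ℤ) := by
    rw [← deriv_weierstrassP]
    exact meromorphicOrderAt_deriv_eq_sub_one (n := -2) (by norm_num)
      (L.order_weierstrassP 0 L.lattice.zero_mem)
  refine MeromorphicOn.meromorphicOrderAt_ne_top_of_isPreconnected (U := Set.univ) (x := 0)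
    (fun z _ => L.meromorphic_derivWeierstrassP z) isPreconnected_univ
    (Set.mem_univ 0) (Set.mem_univ z) ?_
  rw [h0]
  exact WithTop.coe_ne_top

lemma eventually_notMem_lattice {z : ℂ} (hz : z ∉ L.lattice) : ∀ᶠ w in 𝓝 z, w ∉ L.lattice :=
  L.isClosed_lattice.isOpen_compl.mem_nhds hz

lemma hasDerivAt_weierstrassP {z : ℂ} (hz : z ∉ L.lattice) :
    HasDerivAt L.weierstrassP (L.derivWeierstrassP z) z := by
  rw [← deriv_weierstrassP]
  exact (L.analyticOnNhd_weierstrassP z hz).differentiableAt.hasDerivAt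

/-- `℘'' = 6 ℘² - g₂ / 2`. -/
lemma hasDerivAt_derivWeierstrassP {z : ℂ} (hz : z ∉ L.lattice) :
    HasDerivAt L.derivWeierstrassP (6 * L.weierstrassP z ^ 2 - L.g₂ / 2) z := by
  have ha' := L.analyticOnNhd_derivWeierstrassP z hz
  have ha := L.analyticOnNhd_weierstrassP z hz
  set F : ℂ → ℂ := fun w =>
    2 * deriv L.derivWeierstrassP w - (12 * L.weierstrassP w ^ 2 - L.g₂) with hF
  have hFa : AnalyticAt ℂ F z := by
    have := ha'.deriv
    fun_prop
  have hprod : ∀ᶠ w in 𝓝 z, L.derivWeierstrassP w * F w = 0 := by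
    filter_upwards [L.eventually_notMem_lattice hz] with w hw
    have h1 := ((L.analyticOnNhd_derivWeierstrassP w hw).differentiableAt.hasDerivAt).pow 2
    have h2 := L.hasDerivAt_weierstrassP hw
    have h3 : HasDerivAt (fun x => L.derivWeierstrassP x ^ 2)
        (4 * (3 * L.weierstrassP w ^ 2 * L.derivWeierstrassP w)
          - L.g₂ * L.derivWeierstrassP w) w := by
      have h4 := (((h2.pow 3).const_mul 4).sub (h2.const_mul L.g₂)).sub_const L.g₃
      refine (h4.congr_of_eventuallyEq ?_).congr_deriv (by norm_num)
      filter_upwards [L.eventually_notMem_lattice hw] with x hx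
      simpa using L.derivWeierstrassP_sq x hx
    have h5 := h1.unique h3
    simp only [hF]
    norm_num at h5
    linear_combination h5
  -- Since ℘' is not identically zero near z, the product can vanish only if F does near z;
  -- continuity then covers z itself.
  have hF0 : F z = 0 := by
    have htop : meromorphicOrderAt (L.derivWeierstrassP * F) z = ⊤ :=
      meromorphicOrderAt_eq_top_iff.mpr (hprod.filter_mono nhdsWithin_le_nhds)
    rw [meromorphicOrderAt_mul ha'.meromorphicAt hFa.meromorphicAt, WithTop.add_eq_top] at htop
    have h0 := meromorphicOrderAt_eq_top_iff.mp
      (htop.resolve_left (L.order_derivWeierstrassP_ne_top z))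
    exact tendsto_nhds_unique (hFa.continuousAt.tendsto.mono_left nhdsWithin_le_nhds)
      (tendsto_const_nhds.congr' (h0.mono fun w hw => hw.symm))
  refine ha'.differentiableAt.hasDerivAt.congr_deriv ?_
  simp only [hF] at hF0
  linear_combination (1 / 2 : ℂ) * hF0

lemma derivWeierstrassP_half {w : ℂ} (hw : w ∈ L.lattice) : L.derivWeierstrassP (w / 2) = 0 := by
  have h1 := L.derivWeierstrassP_add_coe (-(w / 2)) ⟨w, hw⟩
  rw [L.derivWeierstrassP_neg] at h1
  have h2 : -(w / 2) + w = w / 2 := by ring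
  rw [h2] at h1
  linear_combination (1 / 2 : ℂ) * h1

lemma weierstrassP_half_root {w : ℂ} (hw : w ∈ L.lattice) (hw2 : w / 2 ∉ L.lattice) :
    4 * L.weierstrassP (w / 2) ^ 3 - L.g₂ * L.weierstrassP (w / 2) - L.g₃ = 0 := by
  rw [← L.derivWeierstrassP_sq _ hw2, L.derivWeierstrassP_half hw]
  ring

/-- The values of `℘` at distinct half periods are distinct. -/
lemma sub_mem_lattice_of_weierstrassP_eq {a b : ℂ} (ha : a ∈ L.lattice) (hb : b ∈ L.lattice)
    (ha2 : a / 2 ∉ L.lattice) (hb2 : b / 2 ∉ L.lattice)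
    (h : L.weierstrassP (a / 2) = L.weierstrassP (b / 2)) : (a - b) / 2 ∈ L.lattice := by
  have key : ∀ c : ℂ, c / 2 ∉ L.lattice → ∀ᶠ z in 𝓝 (0 : ℂ), z + c / 2 ∉ L.lattice := by
    intro c hc
    have : Tendsto (fun z : ℂ => z + c / 2) (𝓝 0) (𝓝 (c / 2)) := by
      have : ContinuousAt (fun z : ℂ => z + c / 2) 0 := by fun_prop
      simpa [ContinuousAt] using this
    exact this.eventually (L.eventually_notMem_lattice hc)
  -- The difference satisfies δ'' = δ * S with δ(0) = δ'(0) = 0. A finite vanishing order n would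
  -- satisfy n ≥ n + 2, so δ vanishes near 0 and the two translates have the same poles.
  set δ : ℂ → ℂ := fun z => L.weierstrassP (z + a / 2) - L.weierstrassP (z + b / 2) with hδ
  set δ' : ℂ → ℂ := fun z => L.derivWeierstrassP (z + a / 2) - L.derivWeierstrassP (z + b / 2)
    with hδ'
  set S : ℂ → ℂ := fun z => 6 * (L.weierstrassP (z + a / 2) + L.weierstrassP (z + b / 2)) with hS
  have anP : ∀ c : ℂ, c / 2 ∉ L.lattice →
      AnalyticAt ℂ (fun z => L.weierstrassP (z + c / 2)) 0 := fun c hc =>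
    AnalyticAt.fun_comp (L.analyticOnNhd_weierstrassP _ (by simpa using hc)) (by fun_prop)
  have anP' : ∀ c : ℂ, c / 2 ∉ L.lattice →
      AnalyticAt ℂ (fun z => L.derivWeierstrassP (z + c / 2)) 0 := fun c hc =>
    AnalyticAt.fun_comp (L.analyticOnNhd_derivWeierstrassP _ (by simpa using hc)) (by fun_prop)
  have h1 : AnalyticAt ℂ δ 0 := (anP a ha2).sub (anP b hb2)
  have h2 : AnalyticAt ℂ δ' 0 := (anP' a ha2).sub (anP' b hb2)
  have h3 : AnalyticAt ℂ S 0 := analyticAt_const.mul ((anP a ha2).add (anP b hb2))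
  have d1 : deriv δ =ᶠ[𝓝 0] δ' := by
    filter_upwards [key a ha2, key b hb2] with z hza hzb
    exact (((L.hasDerivAt_weierstrassP hza).comp_add_const z _).sub
      ((L.hasDerivAt_weierstrassP hzb).comp_add_const z _)).deriv
  have d2 : deriv δ' =ᶠ[𝓝 0] δ * S := by
    filter_upwards [key a ha2, key b hb2] with z hza hzb
    have hd : deriv δ' z = _ := (((L.hasDerivAt_derivWeierstrassP hza).comp_add_const z _).sub
      ((L.hasDerivAt_derivWeierstrassP hzb).comp_add_const z _)).deriv
    rw [hd]
    simp only [hδ, hS, Pi.mul_apply]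
    ring
  have z1 : δ 0 = 0 := by simp [hδ, h]
  have z2 : δ' 0 = 0 := by
    simp [hδ', L.derivWeierstrassP_half ha, L.derivWeierstrassP_half hb]
  have o1 := h1.analyticOrderAt_deriv_add_one
  have o2 := h2.analyticOrderAt_deriv_add_one
  simp only [z1, z2, sub_zero] at o1 o2
  rw [analyticOrderAt_congr d1] at o1
  rw [analyticOrderAt_congr d2, analyticOrderAt_mul h1 h3] at o2
  have otop : analyticOrderAt δ 0 = ⊤ := by
    by_contra hne
    obtain ⟨n, hn⟩ := ENat.ne_top_iff_exists.mp hne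
    change analyticOrderAt δ' 0 + 1 = analyticOrderAt δ 0 at o1
    change analyticOrderAt δ 0 + analyticOrderAt S 0 + 1 = analyticOrderAt δ' 0 at o2
    rw [← o2, ← hn] at o1
    have hle : ((n + 2 : ℕ) : ℕ∞) ≤ (n : ℕ∞) := by
      calc ((n + 2 : ℕ) : ℕ∞) = (n : ℕ∞) + 0 + 1 + 1 := by push_cast; ring
        _ ≤ (n : ℕ∞) + analyticOrderAt S 0 + 1 + 1 := by gcongr; exact zero_le
        _ = n := o1
    have := Nat.cast_le.mp hle
    omega
  have hev : (fun z => L.weierstrassP (z + a / 2)) =ᶠ[𝓝[≠] 0]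
      fun z => L.weierstrassP (z + b / 2) := by
    filter_upwards [(analyticOrderAt_eq_top.mp otop).filter_mono nhdsWithin_le_nhds] with z hz
    exact sub_eq_zero.mp hz
  have := (L.mem_lattice_iff_of_eventuallyEq L hev (-(b / 2))).mpr (by simp)
  convert this using 1
  ring

/-! ### Recovering the lattice from g₂ and g₃ -/

/-- A lattice is determined by its invariants `g₂` and `g₃`. -/
lemma mem_lattice_iff_of_invariants_eq (L L' : PeriodPair) (h2 : L.g₂ = L'.g₂)
    (h3 : L.g₃ = L'.g₃) (z : ℂ) : z ∈ L.lattice ↔ z ∈ L'.lattice := by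
  set φ := L.weierstrassPExcept 0 with hφ
  set φ' := L'.weierstrassPExcept 0 with hφ'
  set ψ := L.derivWeierstrassPExcept 0 with hψ
  set ψ' := L'.derivWeierstrassPExcept 0 with hψ'
  have aφ : AnalyticAt ℂ φ 0 := L.analyticAt_weierstrassPExcept 0
  have aφ' : AnalyticAt ℂ φ' 0 := L'.analyticAt_weierstrassPExcept 0
  have aψ : AnalyticAt ℂ ψ 0 := L.analyticAt_derivWeierstrassPExcept 0
  have aψ' : AnalyticAt ℂ ψ' 0 := L'.analyticAt_derivWeierstrassPExcept 0
  have near : ∀ M : PeriodPair, ∀ᶠ w in 𝓝 (0 : ℂ), w ∈ ((M.lattice : Set ℂ) \ {0})ᶜ := fun M =>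
    M.compl_lattice_sdiff_singleton_mem_nhds 0
  have eP : ∀ (M : PeriodPair) (w : ℂ), M.weierstrassP w =
      M.weierstrassPExcept 0 w + 1 / w ^ 2 := by
    intro M w
    have := M.weierstrassPExcept_add ⟨0, M.lattice.zero_mem⟩ w
    simpa using this.symm
  have eP' : ∀ (M : PeriodPair) (w : ℂ),
      M.derivWeierstrassP w = M.derivWeierstrassPExcept 0 w - 2 / w ^ 3 := by
    intro M w
    have := M.derivWeierstrassPExcept_sub ⟨0, M.lattice.zero_mem⟩ w
    simpa using this.symm
  have hdd : ∀ (M : PeriodPair) (w : ℂ), w ∈ ((M.lattice : Set ℂ) \ {0})ᶜ →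
      HasDerivAt (M.weierstrassPExcept 0) (M.derivWeierstrassPExcept 0 w) w := by
    intro M w hw
    rw [← M.eqOn_deriv_weierstrassPExcept_derivWeierstrassPExcept 0 hw]
    exact (M.analyticOnNhd_weierstrassPExcept 0 w hw).differentiableAt.hasDerivAt
  -- Otherwise the difference of the regular parts is w ^ n * g w with g 0 ≠ 0. Subtracting the two
  -- differential equations, clearing w ^ 4 and cancelling w ^ n leaves an identity whose limit at 0
  -- is -4 * n * g 0 = 12 * g 0.
  have hzero : ∀ᶠ w in 𝓝 (0 : ℂ), (fun w => φ w - φ' w) w = 0 := by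
    by_contra hne
    obtain ⟨n, g, ag, g0, hg⟩ :=
      (AnalyticAt.exists_eventuallyEq_pow_smul_nonzero_iff (aφ.sub aφ')).mpr hne
    have heq : ∀ᶠ w in 𝓝[≠] (0 : ℂ),
        (n * g w + w * deriv g w) * (w ^ 3 * (ψ w + ψ' w) - 4) =
          g w * (12 + 12 * w ^ 2 * (φ w + φ' w)
            + 4 * w ^ 4 * (φ w ^ 2 + φ w * φ' w + φ' w ^ 2) - L.g₂ * w ^ 4) := by
      filter_upwards [self_mem_nhdsWithin, hg.eventually_nhds.filter_mono nhdsWithin_le_nhds,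
        (near L).filter_mono nhdsWithin_le_nhds, (near L').filter_mono nhdsWithin_le_nhds,
        ag.eventually_analyticAt.filter_mono nhdsWithin_le_nhds] with w hw hgw hL hL' agw
      have hw0 : w ≠ 0 := hw
      have hwL : w ∉ L.lattice := fun h => hL ⟨h, hw0⟩
      have hwL' : w ∉ L'.lattice := fun h => hL' ⟨h, hw0⟩
      have hδ : φ w - φ' w = w ^ n * g w := by simpa using hgw.self_of_nhds
      have hδ' : w * (ψ w - ψ' w) = w ^ n * (n * g w + w * deriv g w) := by
        have e1 := (hdd L w hL).sub (hdd L' w hL')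
        have e2 : HasDerivAt (fun x => x ^ n * g x)
            (n * w ^ (n - 1) * g w + w ^ n * deriv g w) w :=
          (hasDerivAt_pow n w).mul agw.differentiableAt.hasDerivAt
        have e3 := e1.unique (e2.congr_of_eventuallyEq (hgw.mono fun x hx => by simpa using hx))
        rw [e3]
        rcases n with _ | k
        · simp
        · simp only [Nat.add_sub_cancel]
          ring
      have s1 := L.derivWeierstrassP_sq w hwL
      have s2 := L'.derivWeierstrassP_sq w hwL'
      rw [eP, eP'] at s1 s2
      rw [← h2, ← h3] at s2
      have hd : (ψ w - ψ' w) * (ψ w + ψ' w - 4 / w ^ 3) =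
          (φ w - φ' w) * (4 * ((φ w + 1 / w ^ 2) ^ 2 + (φ w + 1 / w ^ 2) * (φ' w + 1 / w ^ 2)
            + (φ' w + 1 / w ^ 2) ^ 2) - L.g₂) := by
        linear_combination s1 - s2
      have hd2 : (w * (ψ w - ψ' w)) * (w ^ 3 * (ψ w + ψ' w) - 4) =
          (φ w - φ' w) * (12 + 12 * w ^ 2 * (φ w + φ' w)
            + 4 * w ^ 4 * (φ w ^ 2 + φ w * φ' w + φ' w ^ 2) - L.g₂ * w ^ 4) := by
        calc _ = w ^ 4 * ((ψ w - ψ' w) * (ψ w + ψ' w - 4 / w ^ 3)) := by field_simp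
          _ = _ := by rw [hd]; field_simp; ring
      rw [hδ, hδ'] at hd2
      refine mul_left_cancel₀ (pow_ne_zero n hw0) ?_
      linear_combination hd2
    have c1 : ContinuousAt (fun w => (n * g w + w * deriv g w) * (w ^ 3 * (ψ w + ψ' w) - 4)) 0 := by
      have := ag.deriv.continuousAt
      have := ag.continuousAt
      have := aψ.continuousAt
      have := aψ'.continuousAt
      fun_prop
    have c2 : ContinuousAt (fun w => g w * (12 + 12 * w ^ 2 * (φ w + φ' w)
            + 4 * w ^ 4 * (φ w ^ 2 + φ w * φ' w + φ' w ^ 2) - L.g₂ * w ^ 4)) 0 := by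
      have := ag.continuousAt
      have := aφ.continuousAt
      have := aφ'.continuousAt
      fun_prop
    have hlim := tendsto_nhds_unique (c1.tendsto.mono_left nhdsWithin_le_nhds)
      ((c2.tendsto.mono_left nhdsWithin_le_nhds).congr' (heq.mono fun w hw => hw.symm))
    have hfin : (g 0) * ((4 * n + 12 : ℕ) : ℂ) = 0 := by
      push_cast
      simp only [zero_mul, add_zero, ne_eq, OfNat.ofNat_ne_zero, not_false_eq_true, zero_pow,
        mul_zero, sub_zero, zero_sub] at hlim
      linear_combination -hlim
    rcases mul_eq_zero.mp hfin with h | h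
    · exact g0 h
    · exact absurd (Nat.cast_eq_zero.mp h) (by omega)
  have hev : (fun w => L.weierstrassP (w + 0)) =ᶠ[𝓝[≠] 0] fun w => L'.weierstrassP (w + 0) := by
    filter_upwards [hzero.filter_mono nhdsWithin_le_nhds] with w hw
    rw [add_zero, eP, eP]
    linear_combination hw
  simpa using L.mem_lattice_iff_of_eventuallyEq L' hev z

lemma weierstrassP_congr {L L' : PeriodPair} (h : L.lattice = L'.lattice) :
    L.weierstrassP = L'.weierstrassP := by
  funext z
  change (fun Γ : Submodule ℤ ℂ => ∑' l : Γ, (1 / (z - l) ^ 2 - 1 / (l : ℂ) ^ 2)) L.lattice = _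
  rw [h]
  rfl

/-! ### Behaviour under z ↦ c * σ z -/

section Transform

variable {L L' : PeriodPair} {σ : ℂ →+* ℂ} {c : ℂ}

/-- The bijection of lattices induced by `z ↦ c * σ z`. -/
noncomputable def latticeEquivOfMap (hs : Function.Surjective σ) (hc : c ≠ 0)
    (h : ∀ z, z ∈ L.lattice ↔ c * σ z ∈ L'.lattice) : L.lattice ≃ L'.lattice :=
  Equiv.ofBijective (fun l => ⟨c * σ l, (h l).mp l.2⟩) <| by
    refine ⟨fun x y hxy => ?_, fun y => ?_⟩
    · have := congrArg Subtype.val hxy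
      exact Subtype.ext (σ.injective (mul_left_cancel₀ hc this))
    · obtain ⟨z, hz⟩ := hs (y / c)
      have hy : c * σ z = y := by rw [hz]; field_simp
      exact ⟨⟨z, (h z).mpr (hy ▸ y.2)⟩, Subtype.ext hy⟩

lemma latticeEquivOfMap_apply (hs : Function.Surjective σ) (hc : c ≠ 0)
    (h : ∀ z, z ∈ L.lattice ↔ c * σ z ∈ L'.lattice) (l : L.lattice) :
    (latticeEquivOfMap hs hc h l : ℂ) = c * σ l := rfl

/-- The series transforms term by term. A general continuous ring homomorphism σ treats homotheties
and their composites with conjugation together. -/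
lemma weierstrassP_map (hσ : Continuous σ) (hs : Function.Surjective σ) (hc : c ≠ 0)
    (h : ∀ z, z ∈ L.lattice ↔ c * σ z ∈ L'.lattice) (z : ℂ) :
    L'.weierstrassP (c * σ z) = (c ^ 2)⁻¹ * σ (L.weierstrassP z) := by
  have h1 := ((L.hasSum_weierstrassP z).map σ hσ).mul_left (c ^ 2)⁻¹
  have h2 := (latticeEquivOfMap hs hc h).hasSum_iff.mpr (L'.hasSum_weierstrassP (c * σ z))
  refine h2.unique (h1.congr_fun ?_)
  intro l
  simp only [Function.comp_apply, latticeEquivOfMap_apply, map_sub, map_inv₀, map_pow, ← mul_sub,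
    mul_pow, one_div, mul_inv]

lemma G_map (hσ : Continuous σ) (hs : Function.Surjective σ) (hc : c ≠ 0)
    (h : ∀ z, z ∈ L.lattice ↔ c * σ z ∈ L'.lattice) {n : ℕ} (hn : 2 < n) :
    L'.G n = (c ^ n)⁻¹ * σ (L.G n) := by
  have h1 := ((L.hasSum_sumInvPow 0 hn).map σ hσ).mul_left (c ^ n)⁻¹
  have h2 := (latticeEquivOfMap hs hc h).hasSum_iff.mpr (L'.hasSum_sumInvPow 0 hn)
  rw [sumInvPow_zero] at h1 h2
  refine h2.unique (h1.congr_fun ?_)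
  intro l
  simp only [Function.comp_apply, latticeEquivOfMap_apply, map_pow, map_inv₀, mul_pow, mul_inv,
    sub_zero]

end Transform

/-! ### Explicit period pairs and reflections of the lattice -/

/-- The period pair `(x, y)` with `y / x` not real. -/
def ofPair (x y : ℂ) (h : (y / x).im ≠ 0) : PeriodPair where
  ω₁ := x
  ω₂ := y
  indep := by
    have hx : x ≠ 0 := by rintro rfl; simp at h
    rw [LinearIndependent.pair_iff]
    intro s t hst
    have h1 : (s : ℂ) + t * (y / x) = 0 := by
      simp only [Complex.real_smul] at hst
      field_simp
      linear_combination hst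
    have ht : t = 0 := by
      have := congrArg Complex.im h1
      simpa [h] using this
    refine ⟨?_, ht⟩
    simpa [ht] using h1

lemma im_div_ne_zero (L : PeriodPair) : (L.ω₂ / L.ω₁).im ≠ 0 := by
  intro h
  have hx : L.ω₁ ≠ 0 := L.indep.ne_zero 0
  have h1 : L.ω₂ / L.ω₁ = ((L.ω₂ / L.ω₁).re : ℂ) := by
    apply Complex.ext <;> simp [h]
  have h2 := LinearIndependent.pair_iff.mp L.indep (L.ω₂ / L.ω₁).re (-1) (by
    simp only [Complex.real_smul]
    rw [← h1]
    field_simp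
    push_cast
    ring)
  exact absurd h2.2 (by norm_num)

lemma mem_lattice_iff_map_mem {L : PeriodPair} {x y x' y' c : ℂ} {σ : ℂ →+* ℂ} (hc : c ≠ 0)
    (hL : ∀ z, z ∈ L.lattice ↔ ∃ m n : ℤ, m * x + n * y = z)
    (hx : c * σ x = x') (hy : c * σ y = y') (h : (y' / x').im ≠ 0) (z : ℂ) :
    z ∈ L.lattice ↔ c * σ z ∈ (ofPair x' y' h).lattice := by
  rw [hL, mem_lattice]
  refine exists_congr fun m => exists_congr fun n => ?_
  have h1 : (m : ℂ) * x' + n * y' = c * σ (m * x + n * y) := by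
    rw [map_add, map_mul, map_mul, map_intCast, map_intCast, ← hx, ← hy]
    ring
  change _ ↔ (m : ℂ) * x' + n * y' = _
  rw [h1]
  exact ⟨fun h => by rw [h], fun h => σ.injective (mul_left_cancel₀ hc h)⟩

lemma vieta_of_distinct_roots {x y z p q : ℂ} (hx : 4 * x ^ 3 - p * x - q = 0)
    (hy : 4 * y ^ 3 - p * y - q = 0) (hz : 4 * z ^ 3 - p * z - q = 0)
    (hxy : x ≠ y) (hxz : x ≠ z) (hyz : y ≠ z) :
    x + y + z = 0 ∧ p = -4 * (x * y + y * z + x * z) ∧ q = 4 * x * y * z := by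
  have e1 : p = 4 * (x ^ 2 + x * y + y ^ 2) :=
    mul_left_cancel₀ (sub_ne_zero.mpr hxy) (by linear_combination hy - hx)
  have e2 : p = 4 * (x ^ 2 + x * z + z ^ 2) :=
    mul_left_cancel₀ (sub_ne_zero.mpr hxz) (by linear_combination hz - hx)
  have e3 : x + y + z = 0 := by
    refine (mul_eq_zero.mp ?_).resolve_left (sub_ne_zero.mpr hyz)
    linear_combination (e2 - e1) / 4
  have e4 : p = -4 * (x * y + y * z + x * z) := by
    linear_combination e1 + 4 * (x + y) * e3
  refine ⟨e3, e4, ?_⟩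
  linear_combination -hx - x * e4 + 4 * x ^ 2 * e3

/-- If two of the three differences of the half period values have the same absolute value, some
orientation reversing isometry of the lattice exchanges the corresponding classes. -/
lemma exists_reflected_period (L : PeriodPair) {a b c : ℂ} (ha : a ∈ L.lattice)
    (hb : b ∈ L.lattice) (hc : c ∈ L.lattice) (ha2 : a / 2 ∉ L.lattice) (hb2 : b / 2 ∉ L.lattice)
    (hc2 : c / 2 ∉ L.lattice) (hab : (a - b) / 2 ∉ L.lattice) (hac : (a - c) / 2 ∉ L.lattice)
    (hbc : (b - c) / 2 ∉ L.lattice)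
    (h : ‖L.weierstrassP (a / 2) - L.weierstrassP (c / 2)‖ =
      ‖L.weierstrassP (b / 2) - L.weierstrassP (c / 2)‖) :
    ∃ w ∈ L.lattice, ‖w‖ = ‖a‖ ∧ (w - b) / 2 ∈ L.lattice := by
  have nab := mt (L.sub_mem_lattice_of_weierstrassP_eq ha hb ha2 hb2) hab
  have nac := mt (L.sub_mem_lattice_of_weierstrassP_eq ha hc ha2 hc2) hac
  have nbc := mt (L.sub_mem_lattice_of_weierstrassP_eq hb hc hb2 hc2) hbc
  obtain ⟨hsum, hg2, hg3⟩ := vieta_of_distinct_roots (L.weierstrassP_half_root ha ha2)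
    (L.weierstrassP_half_root hb hb2) (L.weierstrassP_half_root hc hc2) nab nac nbc
  set x := L.weierstrassP (a / 2) with hx
  set y := L.weierstrassP (b / 2)
  set z := L.weierstrassP (c / 2)
  have hA : x - z ≠ 0 := sub_ne_zero.mpr nac
  have hA' : conj (x - z) ≠ 0 := (map_ne_zero _).mpr hA
  have hnorm : (x - z) * conj (x - z) = (y - z) * conj (y - z) := by
    rw [Complex.mul_conj', Complex.mul_conj', h]
  -- Equality of the two distances says exactly that this v has norm 1, and z ↦ v * conj z then
  -- exchanges the two differences.
  set v := (y - z) / conj (x - z) with hv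
  have v1 : v * conj (x - z) = y - z := div_mul_cancel₀ _ hA'
  have v2 : v * conj (y - z) = x - z := by
    rw [hv, div_mul_eq_mul_div, ← hnorm, mul_div_cancel_right₀ _ hA']
  have hvn : ‖v‖ = 1 := by
    rw [hv, norm_div, Complex.norm_conj, h, div_self]
    rw [← h]
    exact norm_ne_zero_iff.mpr hA
  have v0 : v ≠ 0 := norm_ne_zero_iff.mp (by rw [hvn]; exact one_ne_zero)
  have hsum' : conj x + conj y + conj z = 0 := by
    rw [← map_add, ← map_add, hsum, map_zero]
  rw [map_sub] at v1 v2
  -- The roots sum to 0, so z is determined by the two differences; this upgrades the exchange of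
  -- differences to one of the roots x and y, with z fixed.
  have vz : v * conj z = z := by
    linear_combination (-1 / 3 : ℂ) * (v1 + v2) - (1 / 3 : ℂ) * hsum + (v / 3) * hsum'
  have vx : v * conj x = y := by linear_combination v1 + vz
  have vy : v * conj y = x := by linear_combination v2 + vz
  -- ℘ scales with weight -2, so acting on its values by v requires acting on periods by u with u ^
  -- 2 = v⁻¹.
  obtain ⟨u, hu⟩ := IsAlgClosed.exists_pow_nat_eq v⁻¹ (n := 2) (by norm_num)
  have u0 : u ≠ 0 := by
    rintro rfl
    exact inv_ne_zero v0 (by rw [← hu]; norm_num)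
  have hun : ‖u‖ = 1 := by
    have : ‖u‖ ^ 2 = 1 := by rw [← norm_pow, hu, norm_inv, hvn, inv_one]
    exact (pow_eq_one_iff_of_nonneg (norm_nonneg u) two_ne_zero).mp this
  have hu2 : (u ^ 2)⁻¹ = v := by rw [hu, inv_inv]
  have hu4 : (u ^ 4)⁻¹ = v ^ 2 := by rw [← hu2]; ring
  have hu6 : (u ^ 6)⁻¹ = v ^ 3 := by rw [← hu2]; ring
  have him : (u * conj L.ω₂ / (u * conj L.ω₁)).im ≠ 0 := by
    rw [mul_div_mul_left _ _ u0, ← map_div₀, Complex.conj_im]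
    exact neg_ne_zero.mpr L.im_div_ne_zero
  have hmap := mem_lattice_iff_map_mem (L := L) (σ := starRingEnd ℂ) u0 (fun _ => mem_lattice)
    rfl rfl him
  set L' := ofPair _ _ him
  have hcont : Continuous (starRingEnd ℂ) := Complex.continuous_conj
  have hsurj : Function.Surjective (starRingEnd ℂ) := fun w => ⟨conj w, Complex.conj_conj w⟩
  have e2 : L.g₂ = L'.g₂ := by
    have h1 : L'.g₂ = v ^ 2 * conj L.g₂ := by
      rw [g₂, g₂, G_map hcont hsurj u0 hmap (by norm_num), hu4, map_mul, map_ofNat]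
      ring
    rw [h1, hg2]
    simp only [map_mul, map_neg, map_ofNat, map_add]
    linear_combination (4 : ℂ) * (v * conj y * vx + y * vy) + 4 * (v * conj z * vy + x * vz)
      + 4 * (v * conj z * vx + y * vz)
  have e3 : L.g₃ = L'.g₃ := by
    have h1 : L'.g₃ = v ^ 3 * conj L.g₃ := by
      rw [g₃, g₃, G_map hcont hsurj u0 hmap (by norm_num), hu6, map_mul, map_ofNat]
      ring
    rw [h1, hg3]
    simp only [map_mul, map_ofNat]
    calc 4 * x * y * z = 4 * (v * conj x) * (v * conj y) * (v * conj z) := by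
          rw [vx, vy, vz]; ring
      _ = _ := by ring
  have hLL : L'.lattice = L.lattice :=
    SetLike.ext fun w => (L.mem_lattice_iff_of_invariants_eq L' e2 e3 w).symm
  have hval : L.weierstrassP (u * conj a / 2) = y := by
    have h1 := weierstrassP_map hcont hsurj u0 hmap (a / 2)
    rw [weierstrassP_congr hLL, hu2, ← hx, vx, map_div₀, map_ofNat] at h1
    rw [← h1]
    ring_nf
  have hw : u * conj a ∈ L.lattice := hLL ▸ (hmap a).mp ha
  have hw2 : u * conj a / 2 ∉ L.lattice := by
    intro hmem
    refine ha2 ((hmap _).mpr ?_)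
    rw [hLL, map_div₀, map_ofNat, ← mul_div_assoc]
    exact hmem
  exact ⟨u * conj a, hw, by rw [norm_mul, hun, Complex.norm_conj, one_mul],
    L.sub_mem_lattice_of_weierstrassP_eq hw hb hw2 hb2 hval⟩

/-! ### Half period values as functions of τ -/

/-- The summands of `℘((i τ + j) / 2)` for the lattice `ℤ + ℤ τ`. -/
noncomputable def halfPeriodTerm (i j : ℤ) (p : Fin 2 → ℤ) (τ : ℂ) : ℂ :=
  1 / ((i * τ + j) / 2 - (p 0 * τ + p 1)) ^ 2 - 1 / (p 0 * τ + p 1) ^ 2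

/-- The value `℘((i τ + j) / 2)` for the lattice `ℤ + ℤ τ`, as a function of `τ`. -/
noncomputable def halfPeriodValue (i j : ℤ) (τ : ℂ) : ℂ := ∑' p, halfPeriodTerm i j p τ

lemma weierstrassP_ofPair_one {τ : ℂ} (h : (τ / 1).im ≠ 0) (i j : ℤ) :
    (ofPair 1 τ h).weierstrassP ((i * τ + j) / 2) = halfPeriodValue i j τ := by
  set L := ofPair 1 τ h with hL
  let e : (Fin 2 → ℤ) ≃ L.lattice :=
    -- The swap is needed because p 0 multiplies τ, the second period.
    ((finTwoArrowEquiv ℤ).trans (Equiv.prodComm ℤ ℤ)).trans L.latticeEquivProd.toEquiv.symm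
  have he : ∀ p : Fin 2 → ℤ, (e p : ℂ) = p 0 * τ + p 1 := by
    intro p
    have := L.latticeEquiv_symm_apply (p 1, p 0)
    change ((L.latticeEquivProd.symm (p 1, p 0) : L.lattice) : ℂ) = _
    rw [this]
    simp only [hL, ofPair]
    ring
  rw [weierstrassP, halfPeriodValue, ← e.tsum_eq]
  refine tsum_congr fun p => ?_
  rw [halfPeriodTerm, he]

lemma int_eq_zero_of_mul_add_eq_zero {τ : ℂ} (h : τ.im ≠ 0) {m n : ℤ}
    (hz : (m : ℂ) * τ + n = 0) : m = 0 ∧ n = 0 := by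
  have h1 : m = 0 := by
    have := congrArg Complex.im hz
    simpa [h] using this
  refine ⟨h1, ?_⟩
  simpa [h1] using hz

lemma continuousAt_halfPeriodTerm {i j : ℤ} (hij : Odd i ∨ Odd j) (p : Fin 2 → ℤ) {τ : ℂ}
    (hτ : τ.im ≠ 0) : ContinuousAt (halfPeriodTerm i j p) τ := by
  unfold halfPeriodTerm
  have h1 : (i * τ + j) / 2 - (p 0 * τ + p 1) ≠ 0 := by
    intro h0
    have h2 : ((i - 2 * p 0 : ℤ) : ℂ) * τ + (j - 2 * p 1 : ℤ) = 0 := by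
      push_cast
      linear_combination 2 * h0
    obtain ⟨h3, h4⟩ := int_eq_zero_of_mul_add_eq_zero hτ h2
    rcases hij with ⟨k, hk⟩ | ⟨k, hk⟩ <;> omega
  refine ContinuousAt.sub (ContinuousAt.div (by fun_prop) (by fun_prop) (pow_ne_zero 2 h1)) ?_
  -- At p = 0 the subtracted term is 1 / 0 = 0, so it is constant in τ; this summand is the 1 / z ^
  -- 2 of ℘.
  by_cases hp : p = 0
  · simp only [hp, Pi.zero_apply, Int.cast_zero, zero_mul, add_zero]
    exact continuousAt_const
  · refine ContinuousAt.div (by fun_prop) (by fun_prop) (pow_ne_zero 2 fun h0 => hp ?_)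
    obtain ⟨h3, h4⟩ := int_eq_zero_of_mul_add_eq_zero hτ h0
    ext k
    fin_cases k
    · exact h3
    · exact h4

/-- Near τ₀ the periods satisfy |p 0 * τ + p 1| ≥ R * ‖p‖ uniformly, so all but finitely many terms
are bounded by a multiple of ‖p‖ ^ (-3), which is summable over ℤ². The convergence is thus uniform
on K. -/
lemma continuousAt_halfPeriodValue {i j : ℤ} (hij : Odd i ∨ Odd j) {τ₀ : ℂ} (hτ : 0 < τ₀.im) :
    ContinuousAt (halfPeriodValue i j) τ₀ := by
  set A : ℝ := |τ₀.re| + 1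
  set B : ℝ := τ₀.im / 2 with hB
  have hB0 : 0 < B := by positivity
  set R : ℝ := EisensteinSeries.r ⟨⟨A, B⟩, hB0⟩
  have hR : 0 < R := EisensteinSeries.r_pos _
  set r : ℝ := |(i : ℝ)| * (‖τ₀‖ + 1) + |(j : ℝ)| + 1 with hr
  have hr0 : 0 < r := by positivity
  set K : Set ℂ := {τ | |τ.re| < A ∧ B < τ.im ∧ ‖τ‖ < ‖τ₀‖ + 1}
  have hK : IsOpen K :=
    (isOpen_lt (f := fun τ : ℂ => |τ.re|) (by fun_prop) continuous_const).inter
      ((isOpen_lt (g := fun τ : ℂ => τ.im) continuous_const (by fun_prop)).inter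
        (isOpen_lt (f := fun τ : ℂ => ‖τ‖) (by fun_prop) continuous_const))
  have hmem : τ₀ ∈ K := ⟨lt_add_one _, half_lt_self hτ, lt_add_one _⟩
  have hsum : Summable fun p : Fin 2 → ℤ => 10 * r * (R ^ (-3 : ℝ) * ‖p‖ ^ (-3 : ℝ)) := by
    refine Summable.mul_left _ (Summable.mul_left _ ?_)
    exact EisensteinSeries.summable_one_div_norm_rpow (k := 3) (by norm_num)
  have hcof : ∀ᶠ p : Fin 2 → ℤ in cofinite, 2 * r / R ≤ ‖p‖ := by
    rw [← cocompact_eq_cofinite]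
    exact tendsto_norm_cocompact_atTop.eventually_ge_atTop _
  have hunif : TendstoUniformlyOn
      (fun (s : Finset (Fin 2 → ℤ)) τ => ∑ p ∈ s, halfPeriodTerm i j p τ)
      (halfPeriodValue i j) atTop K := by
    refine tendstoUniformlyOn_tsum_of_cofinite_eventually hsum ?_
    filter_upwards [hcof] with p hp τ hτK
    obtain ⟨h1, h2, h3⟩ := hτK
    have hp0 : p ≠ 0 := by
      rintro rfl
      rw [norm_zero] at hp
      exact absurd hp (not_le.mpr (by positivity))
    set w : UpperHalfPlane := ⟨τ, hB0.trans h2⟩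
    have hstrip : w ∈ UpperHalfPlane.verticalStrip A B := ⟨h1.le, h2.le⟩
    have hlow : R * ‖p‖ ≤ ‖(p 0 : ℂ) * τ + p 1‖ :=
      (mul_le_mul_of_nonneg_right
        (EisensteinSeries.r_lower_bound_on_verticalStrip w hB0 hstrip) (norm_nonneg p)).trans
        (EisensteinSeries.r_mul_max_le w hp0)
    have hl : 2 * r ≤ ‖(p 0 : ℂ) * τ + p 1‖ := by
      refine le_trans ?_ hlow
      rw [div_le_iff₀ hR] at hp
      linarith
    have hs : ‖((i : ℂ) * τ + j) / 2‖ < r := by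
      have hn : ‖(i : ℂ) * τ + j‖ ≤ |(i : ℝ)| * (‖τ₀‖ + 1) + |(j : ℝ)| := by
        refine (norm_add_le _ _).trans ?_
        rw [norm_mul, Complex.norm_intCast, Complex.norm_intCast]
        gcongr
      rw [norm_div, Complex.norm_ofNat]
      have := norm_nonneg ((i : ℂ) * τ + j)
      linarith
    refine (weierstrassP_bound r hr0 _ hs _ hl).trans ?_
    refine mul_le_mul_of_nonneg_left ?_ (by positivity)
    rw [← Real.mul_rpow hR.le (norm_nonneg p)]
    exact Real.rpow_le_rpow_of_nonpos (mul_pos hR (norm_pos_iff.mpr hp0)) hlow (by norm_num)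
  refine (hunif.continuousOn (Frequently.of_forall fun s => ?_)).continuousAt (hK.mem_nhds hmem)
  refine continuousOn_finsetSum _ fun p _ τ hτK => ?_
  exact (continuousAt_halfPeriodTerm hij p (hB0.trans hτK.2.1).ne').continuousWithinAt

lemma half_mem_lattice_ofPair_one {τ : ℂ} (h : (τ / 1).im ≠ 0) (i j : ℤ)
    (hm : ((i : ℂ) * τ + j) / 2 ∈ (ofPair 1 τ h).lattice) : Even i ∧ Even j := by
  obtain ⟨m, n, hmn⟩ := mem_lattice.mp hm
  change (m : ℂ) * 1 + n * τ = _ at hmn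
  have h2 : ((i - 2 * n : ℤ) : ℂ) * τ + (j - 2 * m : ℤ) = 0 := by
    push_cast
    linear_combination -2 * hmn
  obtain ⟨h3, h4⟩ := int_eq_zero_of_mul_add_eq_zero (by simpa using h) h2
  exact ⟨⟨n, by omega⟩, ⟨m, by omega⟩⟩

lemma one_le_sq_intCast {n : ℤ} (hn : n ≠ 0) : (1 : ℝ) ≤ (n : ℝ) ^ 2 := by
  have h : 0 < n ^ 2 := by positivity
  exact_mod_cast h

/-! ### Sign of the defect -/

/-- For the lattice `ℤ + ℤ τ`, compares the distances of the values of `℘` at `τ / 2` and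
`(1 + τ) / 2` from its value at `1 / 2`. -/
noncomputable def halfPeriodDefect (τ : ℂ) : ℝ :=
  ‖halfPeriodValue 1 0 τ - halfPeriodValue 0 1 τ‖ -
    ‖halfPeriodValue 1 1 τ - halfPeriodValue 0 1 τ‖

lemma continuousAt_halfPeriodDefect {τ : ℂ} (hτ : 0 < τ.im) : ContinuousAt halfPeriodDefect τ := by
  have h1 := continuousAt_halfPeriodValue (i := 1) (j := 0) (Or.inl odd_one) hτ
  have h2 := continuousAt_halfPeriodValue (i := 0) (j := 1) (Or.inr odd_one) hτ
  have h3 := continuousAt_halfPeriodValue (i := 1) (j := 1) (Or.inr odd_one) hτ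
  exact (h1.sub h2).norm.sub (h3.sub h2).norm

lemma halfPeriodDefect_ne_zero {τ : ℂ} (hτ : 0 < τ.im) (h1 : -1 / 2 < τ.re) (h2 : τ.re ≤ 0)
    (h3 : 0 ≤ τ.re ^ 2 + τ.im ^ 2 + τ.re) : halfPeriodDefect τ ≠ 0 := by
  intro h0
  have h : (τ / 1).im ≠ 0 := by simpa using hτ.ne'
  have hv := weierstrassP_ofPair_one h
  have hne := half_mem_lattice_ofPair_one h
  set L := ofPair 1 τ h
  have v10 : L.weierstrassP (τ / 2) = halfPeriodValue 1 0 τ := by simpa using hv 1 0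
  have v01 : L.weierstrassP (1 / 2) = halfPeriodValue 0 1 τ := by simpa using hv 0 1
  have v11 : L.weierstrassP ((τ + 1) / 2) = halfPeriodValue 1 1 τ := by simpa using hv 1 1
  have n10 : τ / 2 ∉ L.lattice := fun hm => by simpa using (hne 1 0 (by simpa using hm)).1
  have n01 : (1 : ℂ) / 2 ∉ L.lattice := fun hm => by simpa using (hne 0 1 (by simpa using hm)).2
  have n11 : (τ + 1) / 2 ∉ L.lattice := fun hm => by simpa using (hne 1 1 (by simpa using hm)).1
  have m1 : (1 : ℂ) ∈ L.lattice := L.ω₁_mem_lattice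
  have mτ : τ ∈ L.lattice := L.ω₂_mem_lattice
  obtain ⟨w, -, hwn, hw⟩ := L.exists_reflected_period mτ (L.lattice.add_mem mτ m1) m1 n10 n11 n01
    (fun hm => by simpa using (hne 0 (-1) (by convert hm using 1; push_cast; ring)).2)
    (fun hm => by simpa using (hne 1 (-1) (by convert hm using 1; push_cast; ring)).1)
    (fun hm => by simpa using (hne 1 0 (by convert hm using 1; push_cast; ring)).1)
    (by rw [v10, v01, v11]; exact sub_eq_zero.mp h0)
  obtain ⟨n, m, hmn⟩ := mem_lattice.mp hw
  change (n : ℂ) * 1 + m * τ = _ at hmn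
  set N : ℤ := 2 * n + 1
  set M : ℤ := 2 * m + 1
  have hw' : w = N + M * τ := by
    simp only [N, M]
    push_cast
    linear_combination -2 * hmn
  have hN : (1 : ℝ) ≤ (N : ℝ) ^ 2 := one_le_sq_intCast (by omega)
  have hM : (1 : ℝ) ≤ (M : ℝ) ^ 2 := one_le_sq_intCast (by omega)
  have hsq : ‖w‖ ^ 2 = ‖τ‖ ^ 2 := by rw [hwn]
  rw [Complex.sq_norm, Complex.sq_norm, Complex.normSq_apply, Complex.normSq_apply, hw'] at hsq
  simp only [Complex.add_re, Complex.mul_re, Complex.add_im, Complex.mul_im, Complex.intCast_re,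
    Complex.intCast_im, zero_mul, sub_zero, zero_add, add_zero] at hsq
  -- With x = Re τ, |w|² = -x * (M - N)² + (|τ|² + x) * M² + (1 + x) * N². As N and M are odd, this
  -- is at least |τ|² + 1 + 2 * x, which exceeds |τ|².
  nlinarith [mul_nonneg (neg_nonneg.mpr h2) (sq_nonneg ((M : ℝ) - N)),
    mul_nonneg h3 (sub_nonneg.mpr hM),
    mul_nonneg (show (0 : ℝ) ≤ 1 + τ.re by linarith) (sub_nonneg.mpr hN)]

/-- Multiplication by i preserves the square lattice and changes the sign of ℘. Hence ℘(i/2) =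
-℘(1/2) and ℘((1 + i)/2) = 0, and the defect is 2|℘(1/2)| - |℘(1/2)|. -/
lemma halfPeriodDefect_I_pos : 0 < halfPeriodDefect Complex.I := by
  have h : (Complex.I / 1).im ≠ 0 := by simp
  have hv := weierstrassP_ofPair_one h
  have hne := half_mem_lattice_ofPair_one h
  have hmul : ∀ z, z ∈ (ofPair 1 Complex.I h).lattice ↔
      Complex.I * RingHom.id ℂ z ∈ (ofPair 1 Complex.I h).lattice := by
    intro z
    simp only [mem_lattice, RingHom.id_apply, ofPair]
    constructor
    · rintro ⟨m, n, rfl⟩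
      refine ⟨-n, m, ?_⟩
      push_cast
      linear_combination -(n : ℂ) * Complex.I_mul_I
    · rintro ⟨m, n, hz⟩
      refine ⟨n, -m, ?_⟩
      push_cast
      linear_combination -Complex.I * hz + (n - z) * Complex.I_mul_I
  set L := ofPair 1 Complex.I h
  have hmap := weierstrassP_map (L := L) (L' := L) (σ := RingHom.id ℂ) continuous_id
    Function.surjective_id Complex.I_ne_zero hmul
  simp only [RingHom.id_apply, Complex.I_sq] at hmap
  have v10 : L.weierstrassP (Complex.I / 2) = halfPeriodValue 1 0 Complex.I := by simpa using hv 1 0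
  have v01 : L.weierstrassP (1 / 2) = halfPeriodValue 0 1 Complex.I := by simpa using hv 0 1
  have v11 : L.weierstrassP ((Complex.I + 1) / 2) = halfPeriodValue 1 1 Complex.I := by
    simpa using hv 1 1
  have n01 : (1 : ℂ) / 2 ∉ L.lattice := fun hm => by simpa using (hne 0 1 (by simpa using hm)).2
  have n11 : (Complex.I + 1) / 2 ∉ L.lattice := fun hm => by
    simpa using (hne 1 1 (by simpa using hm)).1
  have m1 : (1 : ℂ) ∈ L.lattice := L.ω₁_mem_lattice
  have mI : Complex.I ∈ L.lattice := L.ω₂_mem_lattice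
  have e1 : L.weierstrassP (Complex.I / 2) = -L.weierstrassP (1 / 2) := by
    have := hmap (1 / 2)
    rw [show Complex.I * (1 / 2) = Complex.I / 2 by ring] at this
    rw [this]
    norm_num
  have e2 : L.weierstrassP ((Complex.I + 1) / 2) = 0 := by
    have h1 := hmap ((Complex.I + 1) / 2)
    have h2 := L.weierstrassP_add_coe (Complex.I * ((Complex.I + 1) / 2)) ⟨1, m1⟩
    rw [show Complex.I * ((Complex.I + 1) / 2) + ((⟨1, m1⟩ : L.lattice) : ℂ)
      = (Complex.I + 1) / 2 by
        change Complex.I * ((Complex.I + 1) / 2) + 1 = _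
        linear_combination (1 / 2 : ℂ) * Complex.I_mul_I] at h2
    rw [h1] at h2
    have h3 : ((-1 : ℂ))⁻¹ = -1 := by norm_num
    rw [h3] at h2
    linear_combination (1 / 2 : ℂ) * h2
  have e3 : L.weierstrassP (1 / 2) ≠ 0 := by
    rw [← e2]
    intro heq
    have := L.sub_mem_lattice_of_weierstrassP_eq m1 (L.lattice.add_mem mI m1) n01 n11 heq
    simpa using (hne (-1) 0 (by convert this using 1; push_cast; ring)).1
  rw [halfPeriodDefect, ← v10, ← v01, ← v11, e1, e2, zero_sub, norm_neg, ← neg_add', norm_neg,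
    ← two_mul, norm_mul, Complex.norm_ofNat]
  linarith [norm_pos_iff.mpr e3]

lemma pos_of_isPreconnected {s : Set ℝ} (hs : IsPreconnected s) {f : ℝ → ℝ} (hf : ContinuousOn f s)
    (h0 : ∀ x ∈ s, f x ≠ 0) {a b : ℝ} (ha : a ∈ s) (hb : b ∈ s) (h : 0 < f a) : 0 < f b := by
  by_contra hn
  obtain ⟨x, hx, hx0⟩ := hs.intermediate_value hb ha hf ⟨not_lt.mp hn, h.le⟩
  exact h0 x hx hx0

lemma halfPeriodDefect_pos {τ : ℂ} (hτ : 0 < τ.im) (h1 : -1 / 2 < τ.re) (h2 : τ.re ≤ 0)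
    (h3 : 0 ≤ τ.re ^ 2 + τ.im ^ 2 + τ.re) : 0 < halfPeriodDefect τ := by
  -- The path runs from i along the imaginary axis to height Im τ, then horizontally to τ; t ^ 2 + t
  -- increases on (-1/2, 0], so the last inequality persists along the horizontal segment.
  have vert : 0 < halfPeriodDefect ((τ.im : ℂ) * Complex.I) := by
    refine pos_of_isPreconnected (s := Set.Ioi 0) (f := fun t => halfPeriodDefect (t * Complex.I))
      isPreconnected_Ioi (fun t ht => ?_) (fun t ht => ?_) (a := 1) (by simp) hτ ?_
    · refine ContinuousAt.continuousWithinAt (ContinuousAt.comp' (continuousAt_halfPeriodDefect ?_)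
        (by fun_prop))
      simpa using ht
    · refine halfPeriodDefect_ne_zero (by simpa using ht) (by norm_num) (by simp) ?_
      simp only [Complex.re_ofReal_mul, Complex.I_re, mul_zero, add_zero]
      positivity
    · simpa using halfPeriodDefect_I_pos
  have horiz : 0 < halfPeriodDefect ((τ.re : ℂ) + (τ.im : ℂ) * Complex.I) := by
    refine pos_of_isPreconnected (s := Set.Icc τ.re 0)
      (f := fun t => halfPeriodDefect (t + τ.im * Complex.I))
      isPreconnected_Icc (fun t ht => ?_) (fun t ht => ?_) (a := 0) ⟨h2, le_rfl⟩ ⟨le_rfl, h2⟩ ?_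
    · refine ContinuousAt.continuousWithinAt (ContinuousAt.comp' (continuousAt_halfPeriodDefect ?_)
        (by fun_prop))
      simpa using hτ
    · have e1 : ((t : ℂ) + τ.im * Complex.I).re = t := by simp
      have e2 : ((t : ℂ) + τ.im * Complex.I).im = τ.im := by simp
      refine halfPeriodDefect_ne_zero ?_ ?_ ?_ ?_
      · rwa [e2]
      · rw [e1]; linarith [ht.1]
      · rw [e1]; exact ht.2
      · rw [e1, e2]; nlinarith [ht.1, ht.2]
    · simpa using vert
  rwa [Complex.re_add_im] at horiz

/-! ### Obtuse superbases and reduced bases -/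

/-- Three lattice vectors with sum zero, two of which span the lattice, forming a triangle without
obtuse angle. -/
structure IsObtuseSuperbase (L : PeriodPair) (a b c : ℂ) : Prop where
  sum_eq_zero : a + b + c = 0
  mem_iff : ∀ z, z ∈ L.lattice ↔ ∃ m n : ℤ, m * a + n * b = z
  sq_le_left : ‖a‖ ^ 2 ≤ ‖b‖ ^ 2 + ‖c‖ ^ 2
  sq_le_mid : ‖b‖ ^ 2 ≤ ‖a‖ ^ 2 + ‖c‖ ^ 2
  sq_le_right : ‖c‖ ^ 2 ≤ ‖a‖ ^ 2 + ‖b‖ ^ 2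

namespace IsObtuseSuperbase

variable {L : PeriodPair} {a b c : ℂ}

lemma swap (h : L.IsObtuseSuperbase a b c) : L.IsObtuseSuperbase b a c where
  sum_eq_zero := by linear_combination h.sum_eq_zero
  mem_iff z := by
    rw [h.mem_iff, exists_comm]
    simp only [add_comm]
  sq_le_left := h.sq_le_mid
  sq_le_mid := h.sq_le_left
  sq_le_right := by linarith [h.sq_le_right]

/-- Together with `swap` this gives all six orderings, so one superbase serves every labelling of
the roots. -/
lemma rotate (h : L.IsObtuseSuperbase a b c) : L.IsObtuseSuperbase b c a where
  sum_eq_zero := by linear_combination h.sum_eq_zero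
  mem_iff z := by
    rw [h.mem_iff]
    have hs := h.sum_eq_zero
    constructor
    · rintro ⟨m, n, rfl⟩
      refine ⟨n - m, -m, ?_⟩
      push_cast
      linear_combination -(m : ℂ) * hs
    · rintro ⟨m, n, rfl⟩
      refine ⟨-n, m - n, ?_⟩
      push_cast
      linear_combination -(n : ℂ) * hs
  sq_le_left := by linarith [h.sq_le_mid]
  sq_le_mid := by linarith [h.sq_le_right]
  sq_le_right := by linarith [h.sq_le_left]

lemma mem_left (h : L.IsObtuseSuperbase a b c) : a ∈ L.lattice :=
  (h.mem_iff a).mpr ⟨1, 0, by simp⟩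

lemma mem_mid (h : L.IsObtuseSuperbase a b c) : b ∈ L.lattice := h.swap.mem_left

lemma mem_right (h : L.IsObtuseSuperbase a b c) : c ∈ L.lattice := h.rotate.mem_mid

lemma im_div_ne_zero (h : L.IsObtuseSuperbase a b c) : (b / a).im ≠ 0 := by
  intro h0
  rcases eq_or_ne a 0 with rfl | ha
  · obtain ⟨m, n, e1⟩ := (h.mem_iff _).mp L.ω₁_mem_lattice
    obtain ⟨m', n', e2⟩ := (h.mem_iff _).mp L.ω₂_mem_lattice
    refine L.im_div_ne_zero ?_
    rw [← e1, ← e2]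
    rcases eq_or_ne b 0 with rfl | hb
    · simp
    · rw [mul_zero, mul_zero, zero_add, zero_add, mul_div_mul_right _ _ hb]
      simp [Complex.div_im]
  · obtain ⟨m, n, e1⟩ := (h.mem_iff _).mp L.ω₁_mem_lattice
    obtain ⟨m', n', e2⟩ := (h.mem_iff _).mp L.ω₂_mem_lattice
    have hb : b = (b / a).re * a := by
      have : b / a = ((b / a).re : ℂ) := by apply Complex.ext <;> simp [h0]
      rw [← this, div_mul_cancel₀ _ ha]
    set r := (b / a).re
    have key : L.ω₂ / L.ω₁ = ((m' + n' * r) / (m + n * r) : ℝ) := by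
      rw [← e1, ← e2, hb, ← mul_assoc, ← mul_assoc, ← add_mul, ← add_mul,
        mul_div_mul_right _ _ ha]
      push_cast
      rfl
    refine L.im_div_ne_zero ?_
    rw [key, Complex.ofReal_im]

lemma left_ne_zero (h : L.IsObtuseSuperbase a b c) : a ≠ 0 := by
  rintro rfl
  exact h.im_div_ne_zero (by simp)

lemma int_eq_zero (h : L.IsObtuseSuperbase a b c) {m n : ℤ} (hz : (m : ℂ) * a + n * b = 0) :
    m = 0 ∧ n = 0 := by
  have ha := h.left_ne_zero
  have h1 : (n : ℂ) * (b / a) + m = 0 := by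
    field_simp
    linear_combination hz
  exact (int_eq_zero_of_mul_add_eq_zero h.im_div_ne_zero h1).symm

lemma half_notMem (h : L.IsObtuseSuperbase a b c) : a / 2 ∉ L.lattice := by
  intro hm
  obtain ⟨m, n, e⟩ := (h.mem_iff _).mp hm
  have := (h.int_eq_zero (m := 2 * m - 1) (n := 2 * n)
    (by push_cast; linear_combination 2 * e)).1
  omega

lemma half_sub_notMem (h : L.IsObtuseSuperbase a b c) : (a - b) / 2 ∉ L.lattice := by
  intro hm
  obtain ⟨m, n, e⟩ := (h.mem_iff _).mp hm
  have := (h.int_eq_zero (m := 2 * m - 1) (n := 2 * n + 1)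
    (by push_cast; linear_combination 2 * e)).1
  omega

lemma weierstrassP_ne (h : L.IsObtuseSuperbase a b c) :
    L.weierstrassP (a / 2) ≠ L.weierstrassP (b / 2) :=
  mt (L.sub_mem_lattice_of_weierstrassP_eq h.mem_left h.mem_mid h.half_notMem
    h.swap.half_notMem) h.half_sub_notMem

/-- Comparison of half period values after normalising `c` to `1` by `z ↦ k * σ z`. -/
lemma norm_sub_lt_of_map (h : L.IsObtuseSuperbase a b c) (hlt : ‖a‖ < ‖b‖) {σ : ℂ →+* ℂ} {k : ℂ}
    (hσ : Continuous σ) (hs : Function.Surjective σ) (hn : ∀ z, ‖σ z‖ = ‖z‖) (hk : k * σ c = 1)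
    (him : 0 < (k * σ a).im) :
    ‖L.weierstrassP (b / 2) - L.weierstrassP (c / 2)‖ <
      ‖L.weierstrassP (a / 2) - L.weierstrassP (c / 2)‖ := by
  set τ := k * σ a with hτ
  have hk0 : k ≠ 0 := left_ne_zero_of_mul_eq_one hk
  have hkn : 0 < ‖k‖ := norm_pos_iff.mpr hk0
  have hb : k * σ b = -(τ + 1) := by
    have : b = -(a + c) := by linear_combination h.sum_eq_zero
    rw [this, map_neg, map_add, hτ, ← hk]
    ring
  have nc : ‖k‖ * ‖c‖ = 1 := by rw [← hn c, ← norm_mul, hk, norm_one]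
  have na : ‖k‖ * ‖a‖ = ‖τ‖ := by rw [← hn a, ← norm_mul]
  have nb : ‖k‖ * ‖b‖ = ‖τ + 1‖ := by rw [← hn b, ← norm_mul, hb, norm_neg]
  have sq : ‖τ + 1‖ ^ 2 = ‖τ‖ ^ 2 + 2 * τ.re + 1 := by
    rw [Complex.sq_norm, Complex.sq_norm, Complex.normSq_apply, Complex.normSq_apply]
    simp only [Complex.add_re, Complex.add_im, Complex.one_re, Complex.one_im]
    ring
  have sqτ : ‖τ‖ ^ 2 = τ.re ^ 2 + τ.im ^ 2 := by
    rw [Complex.sq_norm, Complex.normSq_apply]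
    ring
  -- After scaling, |a| < |b| becomes Re τ > -1/2, and the angle conditions opposite b and c become
  -- Re τ ≤ 0 and |τ|² + Re τ ≥ 0.
  have c1 : -1 / 2 < τ.re := by
    have : ‖τ‖ < ‖τ + 1‖ := by
      rw [← na, ← nb]
      exact mul_lt_mul_of_pos_left hlt hkn
    have := pow_lt_pow_left₀ this (norm_nonneg _) two_ne_zero
    linarith
  have c2 : τ.re ≤ 0 := by
    have := mul_le_mul_of_nonneg_left h.sq_le_mid (sq_nonneg ‖k‖)
    rw [mul_add, ← mul_pow, ← mul_pow, ← mul_pow, na, nb, nc] at this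
    linarith
  have c3 : 0 ≤ τ.re ^ 2 + τ.im ^ 2 + τ.re := by
    have := mul_le_mul_of_nonneg_left h.sq_le_right (sq_nonneg ‖k‖)
    rw [mul_add, ← mul_pow, ← mul_pow, ← mul_pow, na, nb, nc] at this
    linarith
  have hpos := halfPeriodDefect_pos him c1 c2 c3
  have h1 : (τ / 1).im ≠ 0 := by simpa using him.ne'
  have hmap := mem_lattice_iff_map_mem (σ := σ) hk0 h.rotate.rotate.mem_iff hk hτ.symm h1
  have hP := weierstrassP_map hσ hs hk0 hmap
  have hv := weierstrassP_ofPair_one h1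
  have key : ∀ z : ℂ, k * σ (z / 2) = k * σ z / 2 := fun z => by
    rw [map_div₀, map_ofNat, mul_div_assoc]
  have va : halfPeriodValue 1 0 τ = (k ^ 2)⁻¹ * σ (L.weierstrassP (a / 2)) := by
    rw [← hP, ← hv, key]
    simp [hτ]
  have vc : halfPeriodValue 0 1 τ = (k ^ 2)⁻¹ * σ (L.weierstrassP (c / 2)) := by
    rw [← hP, ← hv, key, hk]
    simp
  have vb : halfPeriodValue 1 1 τ = (k ^ 2)⁻¹ * σ (L.weierstrassP (b / 2)) := by
    rw [← hP, ← hv, key, hb, neg_div, weierstrassP_neg]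
    simp
  rw [halfPeriodDefect, va, vb, vc, ← mul_sub, ← mul_sub, ← map_sub, ← map_sub, norm_mul, norm_mul,
    hn, hn, ← mul_sub] at hpos
  exact sub_pos.mp (pos_of_mul_pos_right hpos (norm_nonneg _))

lemma norm_sub_lt (h : L.IsObtuseSuperbase a b c) (hlt : ‖a‖ < ‖b‖) :
    ‖L.weierstrassP (b / 2) - L.weierstrassP (c / 2)‖ <
      ‖L.weierstrassP (a / 2) - L.weierstrassP (c / 2)‖ := by
  have hc : c ≠ 0 := h.rotate.rotate.left_ne_zero
  -- Conjugation is used when a / c has negative imaginary part, so that τ always lies in the upper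
  -- half plane.
  rcases lt_or_gt_of_ne h.rotate.rotate.im_div_ne_zero with him | him
  · have hc' : conj c ≠ 0 := (map_ne_zero _).mpr hc
    refine h.norm_sub_lt_of_map hlt (σ := starRingEnd ℂ) (k := (conj c)⁻¹)
      Complex.continuous_conj (fun w => ⟨conj w, Complex.conj_conj w⟩) Complex.norm_conj
      (inv_mul_cancel₀ hc') ?_
    rw [inv_mul_eq_div, ← map_div₀, Complex.conj_im]
    exact neg_pos.mpr him
  · refine h.norm_sub_lt_of_map hlt (σ := RingHom.id ℂ) (k := c⁻¹) continuous_id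
      Function.surjective_id (fun _ => rfl) (inv_mul_cancel₀ hc) ?_
    rw [inv_mul_eq_div]
    exact him

/-- Selling's formula: the three coefficients are minus the inner products of pairs from a, b, c,
hence nonnegative. -/
lemma sq_norm_eq (h : L.IsObtuseSuperbase a b c) (m n : ℤ) :
    ‖(m : ℂ) * a + n * b‖ ^ 2 = ((m : ℝ) - n) ^ 2 * ((‖a‖ ^ 2 + ‖b‖ ^ 2 - ‖c‖ ^ 2) / 2)
      + (m : ℝ) ^ 2 * ((‖a‖ ^ 2 + ‖c‖ ^ 2 - ‖b‖ ^ 2) / 2)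
      + (n : ℝ) ^ 2 * ((‖b‖ ^ 2 + ‖c‖ ^ 2 - ‖a‖ ^ 2) / 2) := by
  have hc : c = -(a + b) := by linear_combination h.sum_eq_zero
  rw [hc, norm_neg]
  simp only [Complex.sq_norm, Complex.normSq_apply, Complex.add_re, Complex.add_im, Complex.mul_re,
    Complex.mul_im, Complex.intCast_re, Complex.intCast_im]
  ring

lemma norm_le_of_ne_zero (h : L.IsObtuseSuperbase a b c) (hab : ‖a‖ ≤ ‖b‖) (hbc : ‖b‖ ≤ ‖c‖)
    {m n : ℤ} (hn : n ≠ 0) : ‖b‖ ≤ ‖(m : ℂ) * a + n * b‖ := by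
  refine le_of_sq_le_sq ?_ (norm_nonneg _)
  rw [h.sq_norm_eq]
  have hA := pow_le_pow_left₀ (norm_nonneg a) hab 2
  have hB := pow_le_pow_left₀ (norm_nonneg b) hbc 2
  have h1 := h.sq_le_left
  have h2 := h.sq_le_mid
  have h3 := h.sq_le_right
  have hn1 := one_le_sq_intCast hn
  -- For m = 0 the norm is |n| * ‖b‖. Otherwise m² and n² are at least 1 and the last two terms
  -- already sum to at least ‖c‖² ≥ ‖b‖².
  rcases eq_or_ne m 0 with rfl | hm
  · rw [Int.cast_zero]
    nlinarith [sq_nonneg ‖b‖]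
  · have hm1 := one_le_sq_intCast hm
    nlinarith [mul_nonneg (sq_nonneg ((m : ℝ) - n)) (sub_nonneg.mpr h3),
      mul_nonneg (sub_nonneg.mpr hm1) (sub_nonneg.mpr h2),
      mul_nonneg (sub_nonneg.mpr hn1) (sub_nonneg.mpr h1)]

lemma isReducedBasis (h : L.IsObtuseSuperbase a b c) (hab : ‖a‖ ≤ ‖b‖) (hbc : ‖b‖ ≤ ‖c‖) :
    IsReducedBasis L.lattice a b := by
  have hb : ∀ w ∈ (L.lattice : Set ℂ) \ Set.range (fun n : ℤ => (n : ℂ) * a), ‖b‖ ≤ ‖w‖ := by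
    rintro w ⟨hw, hwa⟩
    obtain ⟨m, n, rfl⟩ := (h.mem_iff w).mp hw
    refine h.norm_le_of_ne_zero hab hbc ?_
    rintro rfl
    exact hwa ⟨m, by simp⟩
  have ha : ∀ w ∈ (L.lattice : Set ℂ) \ {0}, ‖a‖ ≤ ‖w‖ := by
    rintro w ⟨hw, hw0⟩
    by_cases hwa : w ∈ Set.range (fun n : ℤ => (n : ℂ) * a)
    · obtain ⟨n, rfl⟩ := hwa
      have hn : n ≠ 0 := by
        rintro rfl
        simp at hw0
      have h1 : (1 : ℝ) ≤ |(n : ℝ)| := by exact_mod_cast Int.one_le_abs hn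
      simpa using le_mul_of_one_le_left (norm_nonneg a) h1
    · exact hab.trans (hb w ⟨hw, hwa⟩)
  have hbm : b ∈ (L.lattice : Set ℂ) \ Set.range (fun n : ℤ => (n : ℂ) * a) := by
    refine ⟨h.mem_mid, ?_⟩
    rintro ⟨n, hn⟩
    have := (h.int_eq_zero (m := n) (n := -1) (by push_cast; linear_combination hn)).2
    omega
  have ham : a ∈ (L.lattice : Set ℂ) \ {0} := ⟨h.mem_left, h.left_ne_zero⟩
  refine ⟨⟨ham, ?_⟩, hbm, ?_⟩
  · refine (IsLeast.csInf_eq ⟨Set.mem_image_of_mem _ ham, ?_⟩).symm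
    rintro _ ⟨w, hw, rfl⟩
    exact ha w hw
  · refine (IsLeast.csInf_eq ⟨Set.mem_image_of_mem _ hbm, ?_⟩).symm
    rintro _ ⟨w, hw, rfl⟩
    exact hb w hw

lemma exists_reducedBasis (h : L.IsObtuseSuperbase a b c)
    (hord : ProperlyOrdered (L.weierstrassP (a / 2)) (L.weierstrassP (b / 2))
      (L.weierstrassP (c / 2))) :
    ∃ ω₁ ω₂ : ℂ, IsReducedBasis L.lattice ω₁ ω₂ ∧
      L.weierstrassP (a / 2) = L.weierstrassP (ω₁ / 2) ∧
      L.weierstrassP (b / 2) = L.weierstrassP (ω₂ / 2) ∧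
      L.weierstrassP (c / 2) = L.weierstrassP ((ω₁ + ω₂) / 2) := by
  have hab : ‖a‖ ≤ ‖b‖ := not_lt.mp fun hlt => hord.1.not_gt (h.swap.norm_sub_lt hlt)
  have hbc : ‖b‖ ≤ ‖c‖ := by
    refine not_lt.mp fun hlt => hord.2.not_gt ?_
    rw [norm_sub_rev, norm_sub_rev _ (L.weierstrassP (c / 2))]
    exact h.rotate.swap.norm_sub_lt hlt
  refine ⟨a, b, h.isReducedBasis hab hbc, rfl, rfl, ?_⟩
  rw [← L.weierstrassP_neg (c / 2)]
  congr 1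
  linear_combination (-1 / 2 : ℂ) * h.sum_eq_zero

end IsObtuseSuperbase

/-! ### Existence of an obtuse superbase by modular reduction -/

lemma isObtuseSuperbase_of_re_nonpos {L : PeriodPair} {x y w : ℂ}
    (hL : ∀ z, z ∈ L.lattice ↔ ∃ m n : ℤ, m * x + n * y = z) (hw : y = w * x)
    (h1 : 1 ≤ Complex.normSq w) (h2 : -1 / 2 ≤ w.re) (h3 : w.re ≤ 0) :
    L.IsObtuseSuperbase x y (-(x + y)) := by
  have e1 : ‖y‖ ^ 2 = Complex.normSq w * ‖x‖ ^ 2 := by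
    rw [hw, norm_mul, mul_pow, Complex.sq_norm w]
  have e2 : ‖-(x + y)‖ ^ 2 = (1 + 2 * w.re + Complex.normSq w) * ‖x‖ ^ 2 := by
    rw [norm_neg, hw, show x + w * x = (1 + w) * x by ring, norm_mul, mul_pow,
      Complex.sq_norm (1 + w), Complex.normSq_apply, Complex.normSq_apply]
    simp only [Complex.add_re, Complex.add_im, Complex.one_re, Complex.one_im]
    ring
  have hx := sq_nonneg ‖x‖
  refine ⟨by ring, hL, ?_, ?_, ?_⟩ <;> rw [e1, e2] <;> nlinarith

lemma exists_isObtuseSuperbase_of_im_pos {L : PeriodPair} {x y : ℂ}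
    (hL : ∀ z, z ∈ L.lattice ↔ ∃ m n : ℤ, m * x + n * y = z) (him : 0 < (y / x).im) :
    ∃ a b c, L.IsObtuseSuperbase a b c := by
  obtain ⟨g, hg⟩ := ModularGroup.exists_smul_mem_fd ⟨y / x, him⟩
  have hx : x ≠ 0 := by rintro rfl; simp at him
  have hdet : (g 0 0 : ℂ) * g 1 1 - g 0 1 * g 1 0 = 1 := by
    have := g.det_coe
    rw [Matrix.det_fin_two] at this
    exact_mod_cast this
  have hden := UpperHalfPlane.denom_ne_zero (g : Matrix.SpecialLinearGroup (Fin 2) ℝ)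
    ⟨y / x, him⟩
  set w : ℂ := ((g • (⟨y / x, him⟩ : UpperHalfPlane) : UpperHalfPlane) : ℂ) with hw
  rw [UpperHalfPlane.coe_specialLinearGroup_apply] at hw
  simp only [algebraMap_int_eq, eq_intCast, Complex.ofReal_intCast] at hw
  have hden' : (g 1 0 : ℂ) * (y / x) + g 1 1 ≠ 0 := by simpa using! hden
  set x' : ℂ := g 1 0 * y + g 1 1 * x with hx'
  set y' : ℂ := g 0 0 * y + g 0 1 * x with hy'
  have hwxy : y' = w * x' := by
    rw [eq_div_iff hden'] at hw
    have e1 : x' = ((g 1 0 : ℂ) * (y / x) + g 1 1) * x := by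
      rw [hx']
      field_simp
    have e2 : y' = ((g 0 0 : ℂ) * (y / x) + g 0 1) * x := by
      rw [hy']
      field_simp
    rw [e1, e2, ← hw]
    ring
  have hL' : ∀ z, z ∈ L.lattice ↔ ∃ m n : ℤ, m * x' + n * y' = z := by
    intro z
    rw [hL]
    constructor
    · rintro ⟨m, n, rfl⟩
      refine ⟨m * g 0 0 - n * g 0 1, n * g 1 1 - m * g 1 0, ?_⟩
      push_cast
      linear_combination (m * x + n * y) * hdet
    · rintro ⟨m, n, rfl⟩
      refine ⟨m * g 1 1 + n * g 0 1, m * g 1 0 + n * g 0 0, ?_⟩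
      push_cast
      ring
  obtain ⟨h1, h2⟩ := hg
  have h3 := abs_le.mp (show |w.re| ≤ 1 / 2 from h2)
  -- Replacing y' by -y' reflects w to -w, which makes the real part nonpositive; the sign of the
  -- imaginary part plays no role here.
  rcases le_total w.re 0 with h4 | h4
  · exact ⟨_, _, _, isObtuseSuperbase_of_re_nonpos hL' hwxy h1 (by linarith [h3.1]) h4⟩
  · refine ⟨_, _, _, isObtuseSuperbase_of_re_nonpos (x := x') (y := -y') (w := -w) (fun z => ?_)
      (by rw [hwxy, neg_mul]) (by rwa [Complex.normSq_neg])
      (by rw [Complex.neg_re]; linarith [h3.2]) (by rwa [Complex.neg_re, neg_nonpos])⟩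
    rw [hL']
    constructor
    · rintro ⟨m, n, rfl⟩
      exact ⟨m, -n, by push_cast; ring⟩
    · rintro ⟨m, n, rfl⟩
      exact ⟨m, -n, by push_cast; ring⟩

lemma exists_isObtuseSuperbase (L : PeriodPair) : ∃ a b c, L.IsObtuseSuperbase a b c := by
  rcases lt_or_gt_of_ne L.im_div_ne_zero with h | h
  · refine exists_isObtuseSuperbase_of_im_pos (x := L.ω₂) (y := L.ω₁) (fun z => ?_) ?_
    · rw [mem_lattice, exists_comm]
      simp only [add_comm]
    · rw [← inv_div, Complex.inv_im]
      have h0 : L.ω₂ / L.ω₁ ≠ 0 := fun h0 => by simp [h0] at h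
      exact div_pos (neg_pos.mpr h) (Complex.normSq_pos.mpr h0)
  · exact exists_isObtuseSuperbase_of_im_pos (fun _ => mem_lattice) h

end PeriodPair

/-! ### Matching the roots with half periods -/

theorem mainTheorem7 (L : PeriodPair) (e₁ e₂ e₃ : ℂ)
    (he₁ : (weierstrassCubic L).IsRoot e₁)
    (he₂ : (weierstrassCubic L).IsRoot e₂)
    (he₃ : (weierstrassCubic L).IsRoot e₃)
    (h₁₂ : e₁ ≠ e₂) (h₁₃ : e₁ ≠ e₃) (h₂₃ : e₂ ≠ e₃)
    (hord : ProperlyOrdered e₁ e₂ e₃) :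
    ∃ ω₁ ω₂ : ℂ, IsReducedBasis L.lattice ω₁ ω₂ ∧
      e₁ = L.weierstrassP (ω₁ / 2) ∧
      e₂ = L.weierstrassP (ω₂ / 2) ∧
      e₃ = L.weierstrassP ((ω₁ + ω₂) / 2) := by
  obtain ⟨a, b, c, h⟩ := L.exists_isObtuseSuperbase
  obtain ⟨v1, v2, v3⟩ := PeriodPair.vieta_of_distinct_roots
    (L.weierstrassP_half_root h.mem_left h.half_notMem)
    (L.weierstrassP_half_root h.mem_mid h.swap.half_notMem)
    (L.weierstrassP_half_root h.mem_right h.rotate.rotate.half_notMem)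
    h.weierstrassP_ne h.rotate.rotate.weierstrassP_ne.symm h.rotate.weierstrassP_ne
  have root : ∀ e : ℂ, (weierstrassCubic L).IsRoot e → e = L.weierstrassP (a / 2) ∨
      e = L.weierstrassP (b / 2) ∨ e = L.weierstrassP (c / 2) := by
    intro e he
    have h1 : 4 * e ^ 3 - L.g₂ * e - L.g₃ = 0 := by
      simpa [weierstrassCubic, Polynomial.IsRoot] using he
    -- By Vieta the cubic is 4 times the product of these three factors.
    have h2 : (e - L.weierstrassP (a / 2)) *
        ((e - L.weierstrassP (b / 2)) * (e - L.weierstrassP (c / 2))) = 0 := by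
      linear_combination (1 / 4 : ℂ) * h1 + (e / 4) * v2 + (1 / 4 : ℂ) * v3 - e ^ 2 * v1
    simpa only [mul_eq_zero, sub_eq_zero] using h2
  -- Of the 27 assignments, distinctness leaves the six permutations of a, b, c.
  rcases root e₁ he₁ with rfl | rfl | rfl <;> rcases root e₂ he₂ with rfl | rfl | rfl <;>
    rcases root e₃ he₃ with rfl | rfl | rfl <;> first
    | exact absurd rfl h₁₂
    | exact absurd rfl h₁₃
    | exact absurd rfl h₂₃
    | exact h.exists_reducedBasis hord
    | exact h.swap.exists_reducedBasis hord
    | exact h.rotate.exists_reducedBasis hord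
    | exact h.rotate.swap.exists_reducedBasis hord
    | exact h.rotate.rotate.exists_reducedBasis hord
    | exact h.rotate.rotate.swap.exists_reducedBasis hord
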